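/- Let $(\mathcal M,\langle\cdot,\cdot\rangle)$ be a smooth (finite-dimensional, boundaryless) Riemannian manifold and let $\alpha:\mathcal M\to\,]0,\infty[$ be of class $C^2$. Let $\mathcal M_\kappa$ be the manifold $\mathcal M$ with the condition metric $\langle\cdot,\cdot\rangle_{\kappa,x}=\alpha(x)\langle\cdot,\cdot\rangle_x$. For an open set $\mathcal U\subseteq\mathcal M$, we say that $\alpha$ is self-convex in $\mathcal U$ if, for every geodesic $\gamma$ of $\mathcal M_\kappa$ (defined on an interval) that stays in $\mathcal U$, the function $t\mapsto\log\alpha(\gamma(t))$ is convex. A Riemannian submersion $\pi:\mathcal M_1\to\mathcal M_2$ is a smooth submersion such that, for each $x\in\mathcal M_1$, $D\pi(x)$ restricts to an isometry from $(\ker D\pi(x))^\perp$ onto $T_{\pi(x)}\mathcal M_2$. **Proposition.** Let $\mathcal M_1,\mathcal M_2$ be Riemannian manifolds, let $\alpha_2:\mathcal M_2\to\,]0,\infty[$ be of class $C^2$, and let $\pi:\mathcal M_1\to\mathcal M_2$ be a Riemannian submersion. Let $\mathcal U_2\subseteq\mathcal M_2$ be an open set with $\mathcal U_2\subseteq\pi(\mathcal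 M_1)$ (for instance, any open set if $\pi$ is onto), and assume that $\alpha_1=\alpha_2\circ\pi$ is self-convex in $\mathcal U_1=\pi^{-1}(\mathcal U_2)$. Then $\alpha_2$ is self-convex in $\mathcal U_2$. -/

import Mathlib

open Set Bundle Bornology
open scoped Manifold ContDiff Topology

noncomputable section

/-- Riemannian metrics of class `C^n` on a manifold `M` modelled on the vector space `E`. -/
abbrev MetricOn (n : WithTop ℕ∞) (E : Type*) [NormedAddCommGroup E] [NormedSpace ℝ E]
    (M : Type*) [TopologicalSpace M] [ChartedSpace E M] [IsManifold 𝓘(ℝ, E) ∞ M] :=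
  ContMDiffRiemannianMetric 𝓘(ℝ, E) n E (fun x : M => TangentSpace 𝓘(ℝ, E) x)

section OneManifold

variable {E : Type*} [NormedAddCommGroup E] [NormedSpace ℝ E]
  {M : Type*} [TopologicalSpace M] [ChartedSpace E M] [IsManifold 𝓘(ℝ, E) ∞ M]

/-- The condition metric `α(x) ⟨·,·⟩_x`, for a positive function `α` of class `C²`. -/
def conditionMetric (g : MetricOn ∞ E M) (α : M → ℝ)
    (hα : ContMDiff 𝓘(ℝ, E) 𝓘(ℝ, ℝ) 2 α) (hpos : ∀ x, 0 < α x) : MetricOn 2 E M where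
  inner x := α x • g.inner x
  symm x v w := by
    change α x * g.inner x v w = α x * g.inner x w v
    rw [g.symm x v w]
  pos x v hv := mul_pos (hpos x) (g.pos x v hv)
  isVonNBounded x := by
    have hs : 0 < Real.sqrt (α x) := Real.sqrt_pos.2 (hpos x)
    have hss : Real.sqrt (α x) * Real.sqrt (α x) = α x := Real.mul_self_sqrt (hpos x).le
    refine ((g.isVonNBounded x).image
      ((Real.sqrt (α x))⁻¹ • ContinuousLinearMap.id ℝ (TangentSpace 𝓘(ℝ, E) x))).subset ?_
    intro v hv
    refine ⟨Real.sqrt (α x) • v, ?_, ?_⟩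
    · have hv' : α x * g.inner x v v < 1 := hv
      have : g.inner x (Real.sqrt (α x) • v) (Real.sqrt (α x) • v) = α x * g.inner x v v := by
        simp only [map_smul, smul_apply, smul_eq_mul]
        rw [← mul_assoc, hss]
      change g.inner x (Real.sqrt (α x) • v) (Real.sqrt (α x) • v) < 1
      rw [this]
      exact hv'
    · change (Real.sqrt (α x))⁻¹ • (Real.sqrt (α x) • v) = v
      rw [smul_smul, inv_mul_cancel₀ hs.ne', one_smul]
  contMDiff := by
    intro x
    exact ContMDiffAt.smul_section (hα x) ((g.contMDiff.of_le (by exact ENat.LEInfty.out)) x)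

/-- The coordinate expression of the metric `g` in the chart `e`: the scalar product, at the point
of coordinates `y`, of the tangent vectors with coordinates `v` and `w`, i.e. the pullback of `g`
by the local parametrization `e.symm`. -/
def metricInChart (g : MetricOn 2 E M) (e : OpenPartialHomeomorph M E) (y v w : E) : ℝ :=
  g.inner (e.symm y) (mfderiv 𝓘(ℝ, E) 𝓘(ℝ, E) e.symm y v) (mfderiv 𝓘(ℝ, E) 𝓘(ℝ, E) e.symm y w)

/-- The Christoffel symbols of the first kind of `g` in the chart `e`:
`½ (∂_u g(v, w) + ∂_v g(u, w) - ∂_w g(u, v))`. -/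
def christoffelFirst (g : MetricOn 2 E M) (e : OpenPartialHomeomorph M E) (y u v w : E) : ℝ :=
  (1 / 2) * (fderiv ℝ (fun z => metricInChart g e z v w) y u
    + fderiv ℝ (fun z => metricInChart g e z u w) y v
    - fderiv ℝ (fun z => metricInChart g e z u v) y w)

/-- `γ`, restricted to the interval `J`, is a geodesic of the metric `g`: it is of class `C²` on
`J` and, in each chart, `c = e ∘ γ` satisfies `c'' + Γ(c)(c', c') = 0`. The equation is written
after taking the scalar product with an arbitrary vector `w`; at an end point of `J` that belongs
to `J` it follows by continuity. -/
structure IsGeodesicOn (g : MetricOn 2 E M) (γ : ℝ → M) (J : Set ℝ) : Prop where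
  ordConnected : J.OrdConnected
  contMDiffOn : ContMDiffOn 𝓘(ℝ, ℝ) 𝓘(ℝ, E) 2 γ J
  equation : ∀ e ∈ atlas E M, ∀ t ∈ interior J, γ t ∈ e.source → ∀ w : E,
    metricInChart g e (e (γ t)) (deriv (deriv (e ∘ γ)) t) w
      + christoffelFirst g e (e (γ t)) (deriv (e ∘ γ) t) (deriv (e ∘ γ) t) w = 0

/-- The positive `C²` function `α` is self-convex in the (open) set `U`: for each geodesic `γ` of
the condition metric that stays in `U`, the function `log (α (γ t))` is convex. -/
def SelfConvexOn (g : MetricOn ∞ E M) (α : M → ℝ)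
    (hα : ContMDiff 𝓘(ℝ, E) 𝓘(ℝ, ℝ) 2 α) (hpos : ∀ x, 0 < α x) (U : Set M) : Prop :=
  ∀ (γ : ℝ → M) (J : Set ℝ), IsGeodesicOn (conditionMetric g α hα hpos) γ J → MapsTo γ J U →
    ConvexOn ℝ J (fun t => Real.log (α (γ t)))

end OneManifold

section Submersion

variable {E₁ : Type*} [NormedAddCommGroup E₁] [NormedSpace ℝ E₁]
  {M₁ : Type*} [TopologicalSpace M₁] [ChartedSpace E₁ M₁] [IsManifold 𝓘(ℝ, E₁) ∞ M₁]
  {E₂ : Type*} [NormedAddCommGroup E₂] [NormedSpace ℝ E₂]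
  {M₂ : Type*} [TopologicalSpace M₂] [ChartedSpace E₂ M₂] [IsManifold 𝓘(ℝ, E₂) ∞ M₂]

variable (E₂) in
/-- The vector `u` at `x` is horizontal for `p`: it is orthogonal to the kernel of `Dp(x)`. -/
def IsHorizontal (g₁ : MetricOn ∞ E₁ M₁) (p : M₁ → M₂) (x : M₁)
    (u : TangentSpace 𝓘(ℝ, E₁) x) : Prop :=
  ∀ k : TangentSpace 𝓘(ℝ, E₁) x, mfderiv 𝓘(ℝ, E₁) 𝓘(ℝ, E₂) p x k = 0 → g₁.inner x u k = 0

/-- `p` is a Riemannian submersion: a smooth submersion whose derivative at each point is an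
isometry between the horizontal space and the tangent space of the target. -/
structure IsRiemannianSubmersion (g₁ : MetricOn ∞ E₁ M₁) (g₂ : MetricOn ∞ E₂ M₂)
    (p : M₁ → M₂) : Prop where
  contMDiff : ContMDiff 𝓘(ℝ, E₁) 𝓘(ℝ, E₂) ∞ p
  surjective : ∀ x : M₁, Function.Surjective (mfderiv 𝓘(ℝ, E₁) 𝓘(ℝ, E₂) p x)
  isometry : ∀ (x : M₁) (u v : TangentSpace 𝓘(ℝ, E₁) x),
    IsHorizontal E₂ g₁ p x u → IsHorizontal E₂ g₁ p x v →
      g₂.inner (p x) (mfderiv 𝓘(ℝ, E₁) 𝓘(ℝ, E₂) p x u) (mfderiv 𝓘(ℝ, E₁) 𝓘(ℝ, E₂) p x v)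
        = g₁.inner x u v

/-- Composition with a Riemannian submersion preserves the class `C²`. -/
theorem IsRiemannianSubmersion.contMDiff_comp {g₁ : MetricOn ∞ E₁ M₁} {g₂ : MetricOn ∞ E₂ M₂}
    {p : M₁ → M₂} (hp : IsRiemannianSubmersion g₁ g₂ p) {α : M₂ → ℝ}
    (hα : ContMDiff 𝓘(ℝ, E₂) 𝓘(ℝ, ℝ) 2 α) : ContMDiff 𝓘(ℝ, E₁) 𝓘(ℝ, ℝ) 2 (α ∘ p) :=
  hα.comp (hp.contMDiff.of_le (by exact ENat.LEInfty.out))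

end Submersion

end

/-! ### Second-order calculus and geodesic equations in vector spaces. -/

section Calculus

set_option maxSynthPendingDepth 3

variable {E F : Type*} [NormedAddCommGroup E] [NormedSpace ℝ E]
  [NormedAddCommGroup F] [NormedSpace ℝ F]

/-! Convexity of `log (α₂ (γ t))` is a second-order condition at each interior time, and the second
derivative depends only on the 2-jet of `γ`. It therefore suffices to produce, for each interior
`t`, a geodesic of the condition metric of `M₁` whose projection has the same 2-jet as `γ` at `t`:
self-convexity of `α₂ ∘ p` along it gives the sign. No global horizontal lift is needed, nor the
fact that projections of horizontal geodesics are geodesics.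

Since `α₁ = α₂ ∘ p`, both metrics are scaled by the same factor and `p` remains a Riemannian
submersion for the condition metrics. Choose `x` above `γ t`, lift the velocity of `γ` horizontally
to `x`, and solve the geodesic equation upstairs (`exists_geodesic_of_contDiffOn`). The projection
agrees with `γ` in position and velocity at `t`.

Accelerations agree by `geodesicDefect_comp_of_pullback_le`. In coordinates, `B₁ - f^* B₂` is a
field of nonnegative forms that vanishes on horizontal vectors, so these are minima and its
derivative vanishes there. Polarization then matches the Christoffel terms, and the defect
downstairs against `Df w` is the defect upstairs against a horizontal `w`. Horizontal vectors
project onto the whole tangent space, so the projected curve satisfies the geodesic equation of `M₂`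
at time `t`. With `f` a change of charts, the same lemma gives chart independence of the equation.
-/

theorem ContDiffAt.differentiableAt_fderiv_of_two {f : E → F} {x : E} (hf : ContDiffAt ℝ 2 f x) :
    DifferentiableAt ℝ (fderiv ℝ f) x :=
  (hf.fderiv_right (m := 1) (by norm_num)).differentiableAt one_ne_zero

theorem ContDiffAt.eventually_differentiableAt {f : E → F} {x : E} (hf : ContDiffAt ℝ 2 f x) :
    ∀ᶠ z in 𝓝 x, DifferentiableAt ℝ f z :=
  (hf.eventually (by simp)).mono fun _ h => h.differentiableAt two_ne_zero

theorem ContDiffAt.differentiableAt_deriv_of_two {c : ℝ → F} {t : ℝ} (hc : ContDiffAt ℝ 2 c t) :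
    DifferentiableAt ℝ (deriv c) t :=
  hc.differentiableAt_fderiv_of_two.clm_apply (differentiableAt_const (1 : ℝ))

theorem deriv_comp_of_contDiffAt_two {f : E → F} {c : ℝ → E} {t : ℝ}
    (hf : ContDiffAt ℝ 2 f (c t)) (hc : ContDiffAt ℝ 2 c t) :
    deriv (f ∘ c) t = fderiv ℝ f (c t) (deriv c t) :=
  fderiv_comp_deriv t (hf.differentiableAt two_ne_zero) (hc.differentiableAt two_ne_zero)

theorem deriv_deriv_comp_of_contDiffAt_two {f : E → F} {c : ℝ → E} {t : ℝ}
    (hf : ContDiffAt ℝ 2 f (c t)) (hc : ContDiffAt ℝ 2 c t) :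
    deriv (deriv (f ∘ c)) t = fderiv ℝ (fderiv ℝ f) (c t) (deriv c t) (deriv c t)
      + fderiv ℝ f (c t) (deriv (deriv c) t) := by
  have h : deriv (f ∘ c) =ᶠ[𝓝 t] fun s => fderiv ℝ f (c s) (deriv c s) := by
    filter_upwards [hc.eventually_differentiableAt,
      hc.continuousAt.eventually hf.eventually_differentiableAt] with s h1 h2
    exact fderiv_comp_deriv s h2 h1
  rw [h.deriv_eq]
  have h1 : HasDerivAt (fun s => fderiv ℝ f (c s))
      (fderiv ℝ (fderiv ℝ f) (c t) (deriv c t)) t :=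
    hf.differentiableAt_fderiv_of_two.hasFDerivAt.comp_hasDerivAt t
      (hc.differentiableAt two_ne_zero).hasDerivAt
  exact (h1.clm_apply hc.differentiableAt_deriv_of_two.hasDerivAt).deriv

/-- The Christoffel symbols of the first kind of a field `B` of bilinear forms. -/
noncomputable def christoffelForm (B : E → E →L[ℝ] E →L[ℝ] ℝ) (y u v w : E) : ℝ :=
  (1 / 2) * (fderiv ℝ B y u v w + fderiv ℝ B y v u w - fderiv ℝ B y w u v)

/-- The covariant acceleration of the curve `c`, paired with the vector `w`. -/
noncomputable def geodesicDefect (B : E → E →L[ℝ] E →L[ℝ] ℝ) (c : ℝ → E) (t : ℝ) (w : E) : ℝ :=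
  B (c t) (deriv (deriv c) t) w + christoffelForm B (c t) (deriv c t) (deriv c t) w

theorem fderiv_bilin_apply_comm {B : E → F →L[ℝ] F →L[ℝ] ℝ} {y : E} (hB : DifferentiableAt ℝ B y)
    (hsymm : ∀ z u v, B z u v = B z v u) (h : E) (u v : F) :
    fderiv ℝ B y h u v = fderiv ℝ B y h v u := by
  have key : ∀ u v, HasFDerivAt (fun z => B z u v) (((fderiv ℝ B y).flip u).flip v) y := by
    intro u v
    exact ((hB.hasFDerivAt.clm_apply (hasFDerivAt_const u y)).clm_apply
      (hasFDerivAt_const v y)).congr_fderiv (by ext; simp)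
  have h2 := key v u
  simp_rw [hsymm _ v u] at h2
  simpa using congrArg (fun L => L h) ((key u v).unique h2)

theorem DifferentiableAt.hasFDerivAt_comp_fderiv {G : Type*} [NormedAddCommGroup G]
    [NormedSpace ℝ G] {g : F → G} {f : E → F} {y : E} (hg : DifferentiableAt ℝ g (f y))
    (hf : DifferentiableAt ℝ f y) :
    HasFDerivAt (fun z => g (f z)) ((fderiv ℝ g (f y)).comp (fderiv ℝ f y)) y :=
  hg.hasFDerivAt.comp y hf.hasFDerivAt

/-- The derivative of a field of nonnegative forms `B₁ - f^* B₂` vanishes on the vectors at which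
the form vanishes. -/
theorem fderiv_apply_self_of_pullback_le {B₁ : E → E →L[ℝ] E →L[ℝ] ℝ} {B₂ : F → F →L[ℝ] F →L[ℝ] ℝ}
    {f : E → F} {y : E} (hB₁ : DifferentiableAt ℝ B₁ y) (hB₂ : DifferentiableAt ℝ B₂ (f y))
    (hsymm₂ : ∀ z u v, B₂ z u v = B₂ z v u) (hf : ContDiffAt ℝ 2 f y) {u : E}
    (hle : ∀ᶠ z in 𝓝 y, B₂ (f z) (fderiv ℝ f z u) (fderiv ℝ f z u) ≤ B₁ z u u)
    (hu : B₂ (f y) (fderiv ℝ f y u) (fderiv ℝ f y u) = B₁ y u u) (h : E) :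
    fderiv ℝ B₁ y h u u = fderiv ℝ B₂ (f y) (fderiv ℝ f y h) (fderiv ℝ f y u) (fderiv ℝ f y u)
      + 2 * B₂ (f y) (fderiv ℝ (fderiv ℝ f) y h u) (fderiv ℝ f y u) := by
  have h1 : HasFDerivAt (fun z => B₁ z u u) (((fderiv ℝ B₁ y).flip u).flip u) y :=
    ((hB₁.hasFDerivAt.clm_apply (hasFDerivAt_const u y)).clm_apply
      (hasFDerivAt_const u y)).congr_fderiv (by ext; simp)
  have hf2 := hf.differentiableAt_fderiv_of_two.hasFDerivAt.clm_apply (hasFDerivAt_const u y)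
  have hB := DifferentiableAt.hasFDerivAt_comp_fderiv (G := F →L[ℝ] F →L[ℝ] ℝ) hB₂
    (hf.differentiableAt two_ne_zero)
  have h2 := (hB.clm_apply hf2).clm_apply hf2
  -- The vector `u` is kept constant in coordinates: it need be horizontal only at `y`, where the
  -- nonnegative difference reaches its minimum 0.
  have hmin : IsLocalMin (fun z => B₁ z u u - B₂ (f z) (fderiv ℝ f z u) (fderiv ℝ f z u)) y := by
    filter_upwards [hle] with z hz
    simpa [hu] using hz
  have h0 := congrArg (fun L => L h) (hmin.hasFDerivAt_eq_zero (h1.sub h2))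
  simp at h0
  rw [hsymm₂ (f y) (fderiv ℝ f y u)] at h0
  linarith

/-- `B₁ - f^* B₂` has zero derivative on `v = c'`, on `w` and on `v + w`, all horizontal at `c t`.
Hence the Christoffel terms differ only by the pairing of `D²f(v, v)` with `Df w`, which is the
extra term in `(f ∘ c)''`. Horizontality is required at the single time `t`. -/
theorem geodesicDefect_comp_of_pullback_le {B₁ : E → E →L[ℝ] E →L[ℝ] ℝ}
    {B₂ : F → F →L[ℝ] F →L[ℝ] ℝ} {f : E → F} {c : ℝ → E} {t : ℝ}
    (hB₁ : DifferentiableAt ℝ B₁ (c t)) (hB₂ : DifferentiableAt ℝ B₂ (f (c t)))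
    (hsymm₁ : ∀ z u v, B₁ z u v = B₁ z v u) (hsymm₂ : ∀ z u v, B₂ z u v = B₂ z v u)
    (hf : ContDiffAt ℝ 2 f (c t)) (hc : ContDiffAt ℝ 2 c t)
    (hle : ∀ᶠ z in 𝓝 (c t), ∀ u, B₂ (f z) (fderiv ℝ f z u) (fderiv ℝ f z u) ≤ B₁ z u u)
    (hv : ∀ x, B₂ (f (c t)) (fderiv ℝ f (c t) (deriv c t)) (fderiv ℝ f (c t) x)
      = B₁ (c t) (deriv c t) x)
    {w : E} (hw : ∀ x, B₂ (f (c t)) (fderiv ℝ f (c t) w) (fderiv ℝ f (c t) x) = B₁ (c t) w x) :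
    geodesicDefect B₂ (f ∘ c) t (fderiv ℝ f (c t) w) = geodesicDefect B₁ c t w := by
  set y := c t with hy
  set v := deriv c t
  have hvw : B₂ (f y) (fderiv ℝ f y (v + w)) (fderiv ℝ f y (v + w)) = B₁ y (v + w) (v + w) := by
    have h1 := hv (v + w)
    have h2 := hw (v + w)
    rw [map_add (fderiv ℝ f y), map_add (B₂ (f y)), map_add (B₁ y)]
    rw [map_add (fderiv ℝ f y)] at h1 h2
    simp only [add_apply, h1, h2]
  have main : ∀ x, (∀ z, B₂ (f y) (fderiv ℝ f y x) (fderiv ℝ f y z) = B₁ y x z) → _ :=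
    fun x hx => fderiv_apply_self_of_pullback_le (u := x) hB₁ hB₂ hsymm₂ hf
      (hle.mono fun z hz => hz x) (hx x)
  have e1 := main v hv v
  have e2 := main w hw v
  -- With `e1` and `e2`, this polarizes the identity to the mixed pair `(v, w)`.
  have e3 := fderiv_apply_self_of_pullback_le hB₁ hB₂ hsymm₂ hf
      (hle.mono fun z hz => hz (v + w)) hvw v
  have e4 := main v hv w
  have s2 : fderiv ℝ (fderiv ℝ f) y w v = fderiv ℝ (fderiv ℝ f) y v w :=
    (hf.isSymmSndFDerivAt (by simp)) w v
  have s3 := fderiv_bilin_apply_comm hB₁ hsymm₁ v w v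
  have s4 := fderiv_bilin_apply_comm hB₂ hsymm₂ (fderiv ℝ f y v) (fderiv ℝ f y w) (fderiv ℝ f y v)
  have s5 := hsymm₂ (f y) (fderiv ℝ (fderiv ℝ f) y v w) (fderiv ℝ f y v)
  simp only [map_add, add_apply] at e3
  rw [s3, s4] at e3
  rw [s2] at e4
  -- The acceleration of `c` need not be horizontal: that of `w` suffices to compare the pairings.
  have hacc := hw (deriv (deriv c) t)
  rw [hsymm₂, hsymm₁ y w] at hacc
  unfold geodesicDefect christoffelForm
  rw [deriv_comp_of_contDiffAt_two hf hc, deriv_deriv_comp_of_contDiffAt_two hf hc]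
  simp only [Function.comp_apply, ← hy, map_add, add_apply]
  linarith

end Calculus

/-! ### Local existence of geodesics for a field of positive definite forms. -/

section GeodesicExistence

set_option maxSynthPendingDepth 3

variable {E : Type*} [NormedAddCommGroup E] [NormedSpace ℝ E]

/-- The Christoffel form of `B` at `(v, v)`, as a covector. -/
noncomputable def christoffelCovector (B : E → E →L[ℝ] E →L[ℝ] ℝ) (y v : E) : E →L[ℝ] ℝ :=
  fderiv ℝ B y v v - (1 / 2 : ℝ) • ((fderiv ℝ B y).flip v).flip v

theorem christoffelCovector_apply (B : E → E →L[ℝ] E →L[ℝ] ℝ) (y v w : E) :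
    christoffelCovector B y v w = christoffelForm B y v v w := by
  simp [christoffelCovector, christoffelForm]
  ring

variable [FiniteDimensional ℝ E]

theorem isInvertible_of_bilin_pos (b : E →L[ℝ] E →L[ℝ] ℝ) (hb : ∀ v, v ≠ 0 → 0 < b v v) :
    b.IsInvertible := by
  have hinj : Function.Injective b := by
    rw [injective_iff_map_eq_zero]
    intro v hv
    by_contra h
    have := hb v h
    simp [hv] at this
  have hdim : Module.finrank ℝ E = Module.finrank ℝ (E →L[ℝ] ℝ) := by
    rw [← (LinearMap.toContinuousLinearMap (𝕜 := ℝ) (E := E) (F' := ℝ)).finrank_eq]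
    exact (Subspace.dual_finrank_eq (K := ℝ) (V := E)).symm
  exact ⟨(LinearEquiv.ofInjectiveOfFinrankEq (b : E →ₗ[ℝ] E →L[ℝ] ℝ) hinj
    hdim).toContinuousLinearEquiv, by ext; rfl⟩

/-- The vector field on `E × E` whose integral curves are the geodesics of `B`. -/
noncomputable def geodesicField (B : E → E →L[ℝ] E →L[ℝ] ℝ) (z : E × E) : E × E :=
  (z.2, -(B z.1).inverse (christoffelCovector B z.1 z.2))

theorem contDiffAt_geodesicField {B : E → E →L[ℝ] E →L[ℝ] ℝ} {z : E × E}
    (hB : ContDiffAt ℝ 2 B z.1) (hpos : ∀ v, v ≠ 0 → 0 < B z.1 v v) :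
    ContDiffAt ℝ 1 (geodesicField B) z := by
  have h1 : ContDiffAt ℝ 1 (fun z : E × E => fderiv ℝ B z.1) z :=
    ContDiffAt.comp (g := fderiv ℝ B) z (hB.fderiv_right (m := 1) (by norm_num)) contDiffAt_fst
  have h2 : ContDiffAt ℝ 1 (fun z : E × E => (B z.1).inverse) z := by
    obtain ⟨e, he⟩ := isInvertible_of_bilin_pos (B z.1) hpos
    have h : ContDiffAt ℝ 1 (ContinuousLinearMap.inverse : (E →L[ℝ] E →L[ℝ] ℝ) → _) (B z.1) :=
      he ▸ contDiffAt_map_inverse e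
    exact ContDiffAt.comp (g := ContinuousLinearMap.inverse) z h
      (ContDiffAt.comp (g := B) z (hB.of_le (by norm_num)) contDiffAt_fst)
  have h3 : ContDiffAt ℝ 1 (fun z : E × E => christoffelCovector B z.1 z.2) z := by
    have h4 : ContDiffAt ℝ 1 (fun z : E × E => (fderiv ℝ B z.1).flip z.2) z :=
      ContDiffAt.clm_apply ((ContinuousLinearMap.flipₗᵢ ℝ E E (E →L[ℝ] ℝ)).contDiff.contDiffAt.comp
        z h1) contDiffAt_snd
    have h5 : ContDiffAt ℝ 1 (fun z : E × E => ((fderiv ℝ B z.1).flip z.2).flip z.2) z :=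
      ContDiffAt.clm_apply ((ContinuousLinearMap.flipₗᵢ ℝ E E ℝ).contDiff.contDiffAt.comp z h4)
        contDiffAt_snd
    exact ((h1.clm_apply contDiffAt_snd).clm_apply contDiffAt_snd).sub (h5.const_smul (1 / 2 : ℝ))
  exact contDiffAt_snd.prodMk (h2.clm_apply h3).neg

/-- Positivity lets the form be inverted, which turns the paired equation into a first-order system
on `E × E` with a `C¹` field, to which Picard–Lindelöf applies. -/
theorem exists_geodesic_of_contDiffOn {B : E → E →L[ℝ] E →L[ℝ] ℝ} {V : Set E} (hV : IsOpen V)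
    (hB : ContDiffOn ℝ 2 B V) (hpos : ∀ y ∈ V, ∀ v, v ≠ 0 → 0 < B y v v) {y₀ : E} (hy₀ : y₀ ∈ V)
    (v₀ : E) (t₀ : ℝ) :
    ∃ c : ℝ → E, ∃ ε > 0, c t₀ = y₀ ∧ deriv c t₀ = v₀ ∧ ∀ t ∈ Ioo (t₀ - ε) (t₀ + ε),
      c t ∈ V ∧ ContDiffAt ℝ 2 c t ∧ ∀ w, geodesicDefect B c t w = 0 := by
  have hF : ∀ z : E × E, z.1 ∈ V → ContDiffAt ℝ 1 (geodesicField B) z := fun z hz =>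
    contDiffAt_geodesicField (hB.contDiffAt (hV.mem_nhds hz)) (hpos _ hz)
  obtain ⟨z, hz0, ε, hε, hz⟩ :=
    (hF (y₀, v₀) hy₀).exists_forall_mem_closedBall_exists_eq_forall_mem_Ioo_hasDerivAt₀ t₀
  have hzt₀ := (hz t₀ ⟨by linarith, by linarith⟩).continuousAt
  have hVz : ∀ᶠ t in 𝓝 t₀, (z t).1 ∈ V := by
    refine hzt₀.fst.eventually (hV.mem_nhds ?_)
    simpa [hz0] using hy₀
  obtain ⟨δ, hδ, hδV⟩ := Metric.eventually_nhds_iff_ball.1 hVz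
  rw [Real.ball_eq_Ioo] at hδV
  set η := min ε δ with hη
  have hη0 : 0 < η := lt_min hε hδ
  have hz' : ∀ t ∈ Ioo (t₀ - η) (t₀ + η), HasDerivAt z (geodesicField B (z t)) t := fun t ht =>
    hz t ⟨by linarith [ht.1, min_le_left ε δ], by linarith [ht.2, min_le_left ε δ]⟩
  have hV' : ∀ t ∈ Ioo (t₀ - η) (t₀ + η), (z t).1 ∈ V := fun t ht =>
    hδV t ⟨by linarith [ht.1, min_le_right ε δ], by linarith [ht.2, min_le_right ε δ]⟩
  have hc1 : ∀ t ∈ Ioo (t₀ - η) (t₀ + η), HasDerivAt (fun t => (z t).1) (z t).2 t :=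
    fun t ht => (hz' t ht).fst
  have hc2 : ∀ t ∈ Ioo (t₀ - η) (t₀ + η), HasDerivAt (fun t => (z t).2)
      (geodesicField B (z t)).2 t := fun t ht => (hz' t ht).snd
  have hd : EqOn (deriv fun t => (z t).1) (fun t => (z t).2) (Ioo (t₀ - η) (t₀ + η)) :=
    fun t ht => (hc1 t ht).deriv
  -- Bootstrap: the solution is a priori only differentiable. The field is continuous along it, so
  -- the velocity is `C¹` and the position `C²`.
  have hsm2 : ContDiffOn ℝ 1 (fun t => (z t).2) (Ioo (t₀ - η) (t₀ + η)) := by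
    rw [show (1 : WithTop ℕ∞) = 0 + 1 by norm_num, contDiffOn_succ_iff_deriv_of_isOpen isOpen_Ioo]
    refine ⟨fun t ht => (hc2 t ht).differentiableAt.differentiableWithinAt, by simp, ?_⟩
    rw [contDiffOn_zero]
    refine ContinuousOn.congr (f := fun t => (geodesicField B (z t)).2) (fun t ht => ?_)
      fun t ht => (hc2 t ht).deriv
    exact (ContinuousAt.comp (g := geodesicField B) (hF _ (hV' t ht)).continuousAt
      (hz' t ht).continuousAt).snd.continuousWithinAt
  have hsm1 : ContDiffOn ℝ 2 (fun t => (z t).1) (Ioo (t₀ - η) (t₀ + η)) := by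
    rw [show (2 : WithTop ℕ∞) = 1 + 1 by norm_num, contDiffOn_succ_iff_deriv_of_isOpen isOpen_Ioo]
    exact ⟨fun t ht => (hc1 t ht).differentiableAt.differentiableWithinAt, by simp,
      hsm2.congr hd⟩
  refine ⟨fun t => (z t).1, η, hη0, by simp [hz0], ?_, fun t ht => ⟨hV' t ht,
    hsm1.contDiffAt (isOpen_Ioo.mem_nhds ht), fun w => ?_⟩⟩
  · have h := hd (x := t₀) ⟨by linarith, by linarith⟩
    simpa [hz0] using h
  · have h2 : deriv (deriv fun t => (z t).1) t = (geodesicField B (z t)).2 := by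
      rw [(hd.eventuallyEq_of_mem (isOpen_Ioo.mem_nhds ht)).deriv_eq]
      exact (hc2 t ht).deriv
    unfold geodesicDefect
    rw [h2, hd ht, ← christoffelCovector_apply]
    obtain ⟨e, he⟩ := isInvertible_of_bilin_pos (B (z t).1) (hpos _ (hV' t ht))
    simp only [geodesicField, ← he, ContinuousLinearMap.inverse_equiv]
    simp

/-- Orthogonal decomposition with respect to a positive definite form. -/
theorem exists_mem_forall_sub_orthogonal {b : E →L[ℝ] E →L[ℝ] ℝ} (hb : ∀ v, v ≠ 0 → 0 < b v v)
    (K : Submodule ℝ E) (x : E) : ∃ k ∈ K, ∀ l ∈ K, b (x - k) l = 0 := by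
  -- The restriction of `b` to `K` is still positive definite, so some `k` in `K` represents `b x`
  -- on `K`.
  have hK := isInvertible_of_bilin_pos (b.bilinearComp K.subtypeL K.subtypeL) fun v hv => by
    simpa using hb v (by simpa using hv)
  obtain ⟨k, hk⟩ := hK.surjective ((b x).comp K.subtypeL)
  refine ⟨k, k.2, fun l hl => ?_⟩
  have := congrArg (fun L => L ⟨l, hl⟩) hk
  simp at this
  simp [this]

end GeodesicExistence

/-! ### Metrics in coordinates. -/

section MetricInChart

set_option maxSynthPendingDepth 3

variable {E : Type*} [NormedAddCommGroup E] [NormedSpace ℝ E]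
  {M : Type*} [TopologicalSpace M] [ChartedSpace E M] [IsManifold 𝓘(ℝ, E) ∞ M]

/-- The coordinate expression of a metric in a chart, as a field of continuous bilinear forms. -/
noncomputable def metricForm (g : MetricOn 2 E M) (e : OpenPartialHomeomorph M E) (y : E) :
    E →L[ℝ] E →L[ℝ] ℝ :=
  ContinuousLinearMap.bilinearComp (E := E) (F := E) (E' := E) (F' := E) (g.inner (e.symm y))
    (mfderiv 𝓘(ℝ, E) 𝓘(ℝ, E) e.symm y) (mfderiv 𝓘(ℝ, E) 𝓘(ℝ, E) e.symm y)

theorem metricForm_apply (g : MetricOn 2 E M) (e : OpenPartialHomeomorph M E) (y v w : E) :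
    metricForm g e y v w = metricInChart g e y v w := rfl

theorem metricForm_comm (g : MetricOn 2 E M) (e : OpenPartialHomeomorph M E) (y v w : E) :
    metricForm g e y v w = metricForm g e y w v := by
  simp only [metricForm_apply, metricInChart]
  exact g.symm _ _ _

theorem metricForm_pos (g : MetricOn 2 E M) {e : OpenPartialHomeomorph M E} (he : e ∈ atlas E M)
    {y : E} (hy : y ∈ e.target) {v : E} (hv : v ≠ 0) : 0 < metricForm g e y v v := by
  refine g.pos _ _ fun h => hv ?_
  exact (mdifferentiable_of_mem_atlas (I := 𝓘(ℝ, E)) he).symm.mfderiv_injective hy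
    (h.trans (map_zero _).symm)

theorem contDiffOn_metricForm [FiniteDimensional ℝ E] (g : MetricOn 2 E M)
    {e : OpenPartialHomeomorph M E} (he : e ∈ atlas E M) :
    ContDiffOn ℝ 2 (metricForm g e) e.target := by
  refine contDiffOn_clm_apply.2 fun v => contDiffOn_clm_apply.2 fun w => ?_
  have hsymm : ContMDiffOn 𝓘(ℝ, E) 𝓘(ℝ, E) ∞ e.symm e.target :=
    contMDiffOn_symm_of_mem_maximalAtlas (IsManifold.subset_maximalAtlas he)
  -- This section is the tangent map of `e.symm` applied to a constant vector field.
  have key : ∀ v : E, ContMDiffOn 𝓘(ℝ, E) 𝓘(ℝ, E).tangent 2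
      (fun y => (⟨e.symm y, mfderiv 𝓘(ℝ, E) 𝓘(ℝ, E) e.symm y v⟩ : TangentBundle 𝓘(ℝ, E) M))
      e.target := by
    intro v
    have h1 := hsymm.contMDiffOn_tangentMapWithin (m := 2) (by norm_num; exact ENat.LEInfty.out)
      e.open_target.uniqueMDiffOn
    have h2 : ContMDiffOn 𝓘(ℝ, E) 𝓘(ℝ, E).tangent 2
        (fun y => (⟨y, v⟩ : TangentBundle 𝓘(ℝ, E) E)) e.target :=
      contMDiffOn_vectorSpace_iff_contDiffOn.2 contDiffOn_const
    refine (h1.comp h2 fun y hy => hy).congr fun y hy => ?_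
    simp [tangentMapWithin, mfderivWithin_of_isOpen e.open_target hy]
  have hg : ContMDiffOn 𝓘(ℝ, E) (𝓘(ℝ, E).prod 𝓘(ℝ, E →L[ℝ] E →L[ℝ] ℝ)) 2
      (fun y => TotalSpace.mk' (E →L[ℝ] E →L[ℝ] ℝ)
        (E := fun x : M => TangentSpace 𝓘(ℝ, E) x →L[ℝ] TangentSpace 𝓘(ℝ, E) x →L[ℝ] ℝ)
        (e.symm y) (g.inner (e.symm y))) e.target :=
    g.contMDiff.comp_contMDiffOn (hsymm.of_le (by exact ENat.LEInfty.out))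
  have : ContMDiffOn 𝓘(ℝ, E) (𝓘(ℝ, E).prod 𝓘(ℝ)) 2
      (fun y => TotalSpace.mk' ℝ (E := Bundle.Trivial M ℝ) (e.symm y)
        (g.inner (e.symm y) (mfderiv 𝓘(ℝ, E) 𝓘(ℝ, E) e.symm y v)
          (mfderiv 𝓘(ℝ, E) 𝓘(ℝ, E) e.symm y w))) e.target :=
    ContMDiffOn.clm_bundle_apply₂ (F₁ := E) (F₂ := E) hg (key v) (key w)
  intro y hy
  have h := this y hy
  simp only [contMDiffWithinAt_totalSpace] at h
  exact contMDiffWithinAt_iff_contDiffWithinAt.1 h.2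

theorem christoffelFirst_eq_christoffelForm {g : MetricOn 2 E M} {e : OpenPartialHomeomorph M E}
    {y : E} (h : DifferentiableAt ℝ (metricForm g e) y) (u v w : E) :
    christoffelFirst g e y u v w = christoffelForm (metricForm g e) y u v w := by
  have key : ∀ a b c, fderiv ℝ (fun z => metricInChart g e z a b) y c
      = fderiv ℝ (metricForm g e) y c a b := fun a b c => by
    have h1 : HasFDerivAt (fun z => metricForm g e z a b)
        (((fderiv ℝ (metricForm g e) y).flip a).flip b) y :=
      ((h.hasFDerivAt.clm_apply (hasFDerivAt_const a y)).clm_apply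
        (hasFDerivAt_const b y)).congr_fderiv (by ext; simp)
    exact congrArg (fun L => L c) h1.fderiv
  unfold christoffelFirst christoffelForm
  rw [key, key, key]

end MetricInChart

/-! ### Maps between manifolds in coordinates. -/

section Maps

set_option maxSynthPendingDepth 3

variable {E₁ : Type*} [NormedAddCommGroup E₁] [NormedSpace ℝ E₁]
  {M₁ : Type*} [TopologicalSpace M₁] [ChartedSpace E₁ M₁] [IsManifold 𝓘(ℝ, E₁) ∞ M₁]
  {E₂ : Type*} [NormedAddCommGroup E₂] [NormedSpace ℝ E₂]
  {M₂ : Type*} [TopologicalSpace M₂] [ChartedSpace E₂ M₂] [IsManifold 𝓘(ℝ, E₂) ∞ M₂]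
  {p : M₁ → M₂} {e₁ : OpenPartialHomeomorph M₁ E₁} {e₂ : OpenPartialHomeomorph M₂ E₂} {z : E₁}

theorem contDiffAt_coordinates (hp : ContMDiff 𝓘(ℝ, E₁) 𝓘(ℝ, E₂) 2 p) (he₁ : e₁ ∈ atlas E₁ M₁)
    (he₂ : e₂ ∈ atlas E₂ M₂) (hz : z ∈ e₁.target) (hpz : p (e₁.symm z) ∈ e₂.source) :
    ContDiffAt ℝ 2 (e₂ ∘ p ∘ e₁.symm) z := by
  have h1 : ContMDiffAt 𝓘(ℝ, E₁) 𝓘(ℝ, E₁) ∞ e₁.symm z :=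
    contMDiffAt_symm_of_mem_maximalAtlas (IsManifold.subset_maximalAtlas he₁) hz
  have h2 : ContMDiffAt 𝓘(ℝ, E₂) 𝓘(ℝ, E₂) ∞ e₂ (p (e₁.symm z)) :=
    contMDiffAt_of_mem_maximalAtlas (IsManifold.subset_maximalAtlas he₂) hpz
  have h3 : ContMDiffAt 𝓘(ℝ, E₁) 𝓘(ℝ, E₂) 2 (p ∘ e₁.symm) z :=
    (hp (e₁.symm z)).comp z (h1.of_le (by exact ENat.LEInfty.out))
  exact contMDiffAt_iff_contDiffAt.1
    (ContMDiffAt.comp z (h2.of_le (by exact ENat.LEInfty.out)) h3)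

theorem mfderiv_symm_fderiv_coordinates
    (hp : ContMDiff 𝓘(ℝ, E₁) 𝓘(ℝ, E₂) 2 p) (he₁ : e₁ ∈ atlas E₁ M₁)
    (he₂ : e₂ ∈ atlas E₂ M₂) (hz : z ∈ e₁.target) (hpz : p (e₁.symm z) ∈ e₂.source) (u : E₁) :
    (mfderiv 𝓘(ℝ, E₂) 𝓘(ℝ, E₂) e₂.symm ((e₂ ∘ p ∘ e₁.symm) z)
      (fderiv ℝ (e₂ ∘ p ∘ e₁.symm) z u) : E₂)
      = mfderiv 𝓘(ℝ, E₁) 𝓘(ℝ, E₂) p (e₁.symm z) (mfderiv 𝓘(ℝ, E₁) 𝓘(ℝ, E₁) e₁.symm z u) := by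
  set f := e₂ ∘ p ∘ e₁.symm with hf
  have hsymm₁ := mdifferentiableAt_atlas_symm (I := 𝓘(ℝ, E₁)) he₁ hz
  have hfz : f z ∈ e₂.target := e₂.map_source hpz
  have hsymm₂ := mdifferentiableAt_atlas_symm (I := 𝓘(ℝ, E₂)) he₂ hfz
  have hfd : MDifferentiableAt 𝓘(ℝ, E₁) 𝓘(ℝ, E₂) f z :=
    ((contDiffAt_coordinates hp he₁ he₂ hz hpz).differentiableAt
      two_ne_zero).mdifferentiableAt
  have hpd := (hp (e₁.symm z)).mdifferentiableAt two_ne_zero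
  have hev : e₂.symm ∘ f =ᶠ[𝓝 z] p ∘ e₁.symm := by
    have hcont : ContinuousAt (p ∘ e₁.symm) z :=
      ContinuousAt.comp hp.continuous.continuousAt (e₁.symm.continuousAt hz)
    filter_upwards [hcont.preimage_mem_nhds (e₂.open_source.mem_nhds hpz)] with y hy
    exact e₂.left_inv hy
  have hL := (HasMFDerivAt.comp z hsymm₂.hasMFDerivAt hfd.hasMFDerivAt).congr_of_eventuallyEq
    hev.symm
  have hR := HasMFDerivAt.comp z hpd.hasMFDerivAt hsymm₁.hasMFDerivAt
  have hD := hasMFDerivAt_unique hL hR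
  rw [← mfderiv_eq_fderiv]
  exact congrArg (fun L : E₁ →L[ℝ] E₂ => L u) hD

theorem metricForm_fderiv_coordinates (g : MetricOn 2 E₂ M₂)
    (hp : ContMDiff 𝓘(ℝ, E₁) 𝓘(ℝ, E₂) 2 p) (he₁ : e₁ ∈ atlas E₁ M₁)
    (he₂ : e₂ ∈ atlas E₂ M₂) (hz : z ∈ e₁.target) (hpz : p (e₁.symm z) ∈ e₂.source) (u v : E₁) :
    metricForm g e₂ ((e₂ ∘ p ∘ e₁.symm) z) (fderiv ℝ (e₂ ∘ p ∘ e₁.symm) z u)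
        (fderiv ℝ (e₂ ∘ p ∘ e₁.symm) z v)
      = g.inner (p (e₁.symm z))
        (mfderiv 𝓘(ℝ, E₁) 𝓘(ℝ, E₂) p (e₁.symm z) (mfderiv 𝓘(ℝ, E₁) 𝓘(ℝ, E₁) e₁.symm z u))
        (mfderiv 𝓘(ℝ, E₁) 𝓘(ℝ, E₂) p (e₁.symm z) (mfderiv 𝓘(ℝ, E₁) 𝓘(ℝ, E₁) e₁.symm z v)) := by
  -- Tangent spaces at equal points are formally distinct types; viewing the vectors in `E₂` allows
  -- the base point to be replaced.
  have hpt : ∀ a b : M₂, a = b → ∀ v w : E₂, (g.inner a : E₂ →L[ℝ] E₂ →L[ℝ] ℝ) v w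
      = (g.inner b : E₂ →L[ℝ] E₂ →L[ℝ] ℝ) v w := by
    rintro a _ rfl v w; rfl
  refine Eq.trans (hpt (e₂.symm ((e₂ ∘ p ∘ e₁.symm) z)) (p (e₁.symm z)) (e₂.left_inv hpz)
    (mfderiv 𝓘(ℝ, E₂) 𝓘(ℝ, E₂) e₂.symm _ (fderiv ℝ (e₂ ∘ p ∘ e₁.symm) z u))
    (mfderiv 𝓘(ℝ, E₂) 𝓘(ℝ, E₂) e₂.symm _ (fderiv ℝ (e₂ ∘ p ∘ e₁.symm) z v))) ?_
  rw [mfderiv_symm_fderiv_coordinates hp he₁ he₂ hz hpz u,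
    mfderiv_symm_fderiv_coordinates hp he₁ he₂ hz hpz v]

theorem geodesicDefect_map [FiniteDimensional ℝ E₁] [FiniteDimensional ℝ E₂]
    {g₁ : MetricOn 2 E₁ M₁} {g₂ : MetricOn 2 E₂ M₂}
    (hp : ContMDiff 𝓘(ℝ, E₁) 𝓘(ℝ, E₂) 2 p)
    (hle : ∀ x u, g₂.inner (p x) (mfderiv 𝓘(ℝ, E₁) 𝓘(ℝ, E₂) p x u)
      (mfderiv 𝓘(ℝ, E₁) 𝓘(ℝ, E₂) p x u) ≤ g₁.inner x u u)
    (he₁ : e₁ ∈ atlas E₁ M₁) (he₂ : e₂ ∈ atlas E₂ M₂) {c : ℝ → E₁} {t : ℝ}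
    (hc : ContDiffAt ℝ 2 c t) (hz : c t ∈ e₁.target) (hpz : p (e₁.symm (c t)) ∈ e₂.source)
    (hv : ∀ x, metricForm g₂ e₂ ((e₂ ∘ p ∘ e₁.symm) (c t))
      (fderiv ℝ (e₂ ∘ p ∘ e₁.symm) (c t) (deriv c t)) (fderiv ℝ (e₂ ∘ p ∘ e₁.symm) (c t) x)
      = metricForm g₁ e₁ (c t) (deriv c t) x)
    {w : E₁} (hw : ∀ x, metricForm g₂ e₂ ((e₂ ∘ p ∘ e₁.symm) (c t))
      (fderiv ℝ (e₂ ∘ p ∘ e₁.symm) (c t) w) (fderiv ℝ (e₂ ∘ p ∘ e₁.symm) (c t) x)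
      = metricForm g₁ e₁ (c t) w x) :
    geodesicDefect (metricForm g₂ e₂) ((e₂ ∘ p ∘ e₁.symm) ∘ c) t
      (fderiv ℝ (e₂ ∘ p ∘ e₁.symm) (c t) w) = geodesicDefect (metricForm g₁ e₁) c t w := by
  have hB₁ := (contDiffOn_metricForm g₁ he₁).contDiffAt (e₁.open_target.mem_nhds hz)
  have hB₂ := (contDiffOn_metricForm g₂ he₂).contDiffAt
    (e₂.open_target.mem_nhds (e₂.map_source hpz))
  refine geodesicDefect_comp_of_pullback_le (hB₁.differentiableAt two_ne_zero)
    (hB₂.differentiableAt two_ne_zero) (metricForm_comm g₁ e₁) (metricForm_comm g₂ e₂)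
    (contDiffAt_coordinates hp he₁ he₂ hz hpz) hc ?_ hv hw
  have hcont : ContinuousAt (p ∘ e₁.symm) (c t) :=
    ContinuousAt.comp hp.continuous.continuousAt (e₁.symm.continuousAt hz)
  filter_upwards [hcont.preimage_mem_nhds (e₂.open_source.mem_nhds hpz),
    e₁.open_target.mem_nhds hz] with y hy hy' u
  rw [metricForm_fderiv_coordinates g₂ hp he₁ he₂ hy' hy]
  exact hle _ _

end Maps

/-! ### Geodesics in charts and chart independence. -/

section Geodesics

set_option maxSynthPendingDepth 3

variable {E : Type*} [NormedAddCommGroup E] [NormedSpace ℝ E]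
  {M : Type*} [TopologicalSpace M] [ChartedSpace E M] [IsManifold 𝓘(ℝ, E) ∞ M]

theorem IsGeodesicOn.contDiffAt_chart {g : MetricOn 2 E M} {γ : ℝ → M} {J : Set ℝ}
    (h : IsGeodesicOn g γ J) {e : OpenPartialHomeomorph M E} (he : e ∈ atlas E M) {t : ℝ}
    (ht : t ∈ interior J) (hte : γ t ∈ e.source) : ContDiffAt ℝ 2 (e ∘ γ) t := by
  have h1 : ContMDiffAt 𝓘(ℝ, E) 𝓘(ℝ, E) ∞ e (γ t) :=
    contMDiffAt_of_mem_maximalAtlas (IsManifold.subset_maximalAtlas he) hte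
  exact contMDiffAt_iff_contDiffAt.1 ((h1.of_le (by exact ENat.LEInfty.out)).comp t
    (h.contMDiffOn.contMDiffAt (mem_interior_iff_mem_nhds.1 ht)))

variable [FiniteDimensional ℝ E]

theorem differentiableAt_metricForm (g : MetricOn 2 E M) {e : OpenPartialHomeomorph M E}
    (he : e ∈ atlas E M) {y : E} (hy : y ∈ e.target) :
    DifferentiableAt ℝ (metricForm g e) y :=
  ((contDiffOn_metricForm g he).contDiffAt (e.open_target.mem_nhds hy)).differentiableAt
    two_ne_zero

theorem geodesicDefect_eq (g : MetricOn 2 E M) {e : OpenPartialHomeomorph M E}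
    (he : e ∈ atlas E M) {c : ℝ → E} {t : ℝ} (hc : c t ∈ e.target) (w : E) :
    geodesicDefect (metricForm g e) c t w = metricInChart g e (c t) (deriv (deriv c) t) w
      + christoffelFirst g e (c t) (deriv c t) (deriv c t) w := by
  rw [geodesicDefect, metricForm_apply,
    christoffelFirst_eq_christoffelForm (differentiableAt_metricForm g he hc)]

/-- The geodesic equation in one chart implies the geodesic equation in every chart. -/
theorem isGeodesicOn_symm_comp {g : MetricOn 2 E M} {e : OpenPartialHomeomorph M E}
    (he : e ∈ atlas E M) {c : ℝ → E} {J : Set ℝ} (hJ : J.OrdConnected)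
    (hc : ∀ t ∈ J, c t ∈ e.target) (hc2 : ∀ t ∈ J, ContDiffAt ℝ 2 c t)
    (hgeod : ∀ t ∈ J, ∀ w, geodesicDefect (metricForm g e) c t w = 0) :
    IsGeodesicOn g (e.symm ∘ c) J where
  ordConnected := hJ
  contMDiffOn t ht := by
    have h1 : ContMDiffAt 𝓘(ℝ, E) 𝓘(ℝ, E) ∞ e.symm (c t) :=
      contMDiffAt_symm_of_mem_maximalAtlas (IsManifold.subset_maximalAtlas he) (hc t ht)
    exact ((h1.of_le (by exact ENat.LEInfty.out)).comp t
      (contMDiffAt_iff_contDiffAt.2 (hc2 t ht))).contMDiffWithinAt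
  equation e' he' t ht hte w := by
    replace ht := interior_subset ht
    have hz := hc t ht
    have hid : ContMDiff 𝓘(ℝ, E) 𝓘(ℝ, E) 2 (id : M → M) := contMDiff_id
    have hpull : ∀ u x, metricForm g e' ((e' ∘ id ∘ e.symm) (c t))
        (fderiv ℝ (e' ∘ id ∘ e.symm) (c t) u) (fderiv ℝ (e' ∘ id ∘ e.symm) (c t) x)
        = metricForm g e (c t) u x := fun u x => by
      rw [metricForm_fderiv_coordinates g hid he he' hz hte, mfderiv_id]
      rfl
    -- The change of charts preserves a positive definite form, so its derivative is injective,
    -- hence onto: every test vector `w` is an image.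
    have hinj : Function.Injective (fderiv ℝ (e' ∘ id ∘ e.symm) (c t)) := by
      rw [injective_iff_map_eq_zero]
      intro u hu
      by_contra hne
      have h1 := metricForm_pos g he hz hne
      rw [← hpull, hu] at h1
      simp at h1
    obtain ⟨w', rfl⟩ : ∃ w', fderiv ℝ (e' ∘ id ∘ e.symm) (c t) w' = w :=
      (LinearMap.injective_iff_surjective
        (f := (fderiv ℝ (e' ∘ id ∘ e.symm) (c t) : E →ₗ[ℝ] E))).1 hinj w
    have hmap := geodesicDefect_map (g₁ := g) (g₂ := g) hid (fun x u => by rw [mfderiv_id]; rfl)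
      he he' (hc2 t ht) hz hte (hpull _) (hpull w')
    rw [hgeod t ht, geodesicDefect_eq g he' (e'.map_source hte)] at hmap
    exact hmap

theorem IsGeodesicOn.geodesicDefect_eq_zero {g : MetricOn 2 E M} {γ : ℝ → M} {J : Set ℝ}
    (h : IsGeodesicOn g γ J) {e : OpenPartialHomeomorph M E} (he : e ∈ atlas E M) {t : ℝ}
    (ht : t ∈ interior J) (hte : γ t ∈ e.source) (w : E) :
    geodesicDefect (metricForm g e) (e ∘ γ) t w = 0 := by
  rw [geodesicDefect_eq g he (e.map_source hte)]
  exact h.equation e he t ht hte w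

end Geodesics

theorem ConvexOn.deriv_deriv_nonneg {f : ℝ → ℝ} {s : Set ℝ} (hs : IsOpen s)
    (hf : ConvexOn ℝ s f) (hd : ∀ x ∈ s, DifferentiableAt ℝ f x) {x : ℝ} (hx : x ∈ s) :
    0 ≤ deriv (deriv f) x := by
  have hmono := hf.monotoneOn_deriv hd
  rw [← derivWithin_of_isOpen hs hx]
  exact hmono.derivWithin_nonneg

/-! ### Horizontal vectors of a Riemannian submersion. -/

section RiemannianSubmersion

set_option maxSynthPendingDepth 3

variable {E₁ : Type*} [NormedAddCommGroup E₁] [NormedSpace ℝ E₁] [FiniteDimensional ℝ E₁]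
  {M₁ : Type*} [TopologicalSpace M₁] [ChartedSpace E₁ M₁] [IsManifold 𝓘(ℝ, E₁) ∞ M₁]
  {E₂ : Type*} [NormedAddCommGroup E₂] [NormedSpace ℝ E₂]
  {M₂ : Type*} [TopologicalSpace M₂] [ChartedSpace E₂ M₂]

theorem exists_isHorizontal_add (g₁ : MetricOn ∞ E₁ M₁) (p : M₁ → M₂) (x : M₁)
    (u : TangentSpace 𝓘(ℝ, E₁) x) : ∃ h k : TangentSpace 𝓘(ℝ, E₁) x, u = h + k ∧
      IsHorizontal E₂ g₁ p x h ∧ mfderiv 𝓘(ℝ, E₁) 𝓘(ℝ, E₂) p x k = 0 := by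
  let D : E₁ →L[ℝ] E₂ := mfderiv 𝓘(ℝ, E₁) 𝓘(ℝ, E₂) p x
  obtain ⟨k, hk, hl⟩ : ∃ k : TangentSpace 𝓘(ℝ, E₁) x, mfderiv 𝓘(ℝ, E₁) 𝓘(ℝ, E₂) p x k = 0 ∧
      ∀ l, mfderiv 𝓘(ℝ, E₁) 𝓘(ℝ, E₂) p x l = 0 → g₁.inner x (u - k) l = 0 :=
    exists_mem_forall_sub_orthogonal (E := E₁) (b := g₁.inner x)
      (fun v hv => g₁.pos x v hv) (LinearMap.ker (D : E₁ →ₗ[ℝ] E₂)) u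
  exact ⟨u - k, k, (sub_add_cancel u k).symm, fun l hl' => hl l hl', hk⟩

variable [IsManifold 𝓘(ℝ, E₂) ∞ M₂]
  {g₁ : MetricOn ∞ E₁ M₁} {g₂ : MetricOn ∞ E₂ M₂} {p : M₁ → M₂}

theorem IsRiemannianSubmersion.inner_mfderiv_of_isHorizontal
    (hp : IsRiemannianSubmersion g₁ g₂ p) {x : M₁} {u : TangentSpace 𝓘(ℝ, E₁) x}
    (hu : IsHorizontal E₂ g₁ p x u) (v : TangentSpace 𝓘(ℝ, E₁) x) :
    g₂.inner (p x) (mfderiv 𝓘(ℝ, E₁) 𝓘(ℝ, E₂) p x u) (mfderiv 𝓘(ℝ, E₁) 𝓘(ℝ, E₂) p x v)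
      = g₁.inner x u v := by
  obtain ⟨h, k, rfl, hh, hk⟩ := exists_isHorizontal_add (E₂ := E₂) g₁ p x v
  rw [map_add, hk, add_zero, hp.isometry x u h hu hh, map_add, hu k hk, add_zero]

/-- By Pythagoras: `Dp` kills the vertical part and preserves the norm of the horizontal one. -/
theorem IsRiemannianSubmersion.inner_mfderiv_le (hp : IsRiemannianSubmersion g₁ g₂ p) (x : M₁)
    (v : TangentSpace 𝓘(ℝ, E₁) x) :
    g₂.inner (p x) (mfderiv 𝓘(ℝ, E₁) 𝓘(ℝ, E₂) p x v) (mfderiv 𝓘(ℝ, E₁) 𝓘(ℝ, E₂) p x v)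
      ≤ g₁.inner x v v := by
  obtain ⟨h, k, rfl, hh, hk⟩ := exists_isHorizontal_add (E₂ := E₂) g₁ p x v
  have hkk : 0 ≤ g₁.inner x k k := by
    by_cases hk0 : k = 0
    · simp [hk0]
    · exact (g₁.pos x k hk0).le
  have h1 := hp.isometry x h h hh hh
  have h2 := hh k hk
  have h3 := g₁.symm x k h
  rw [map_add, hk, add_zero, h1]
  simp only [map_add, add_apply]
  linarith

theorem IsRiemannianSubmersion.exists_isHorizontal_lift (hp : IsRiemannianSubmersion g₁ g₂ p)
    (x : M₁) (w : TangentSpace 𝓘(ℝ, E₂) (p x)) : ∃ u : TangentSpace 𝓘(ℝ, E₁) x,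
      IsHorizontal E₂ g₁ p x u ∧ mfderiv 𝓘(ℝ, E₁) 𝓘(ℝ, E₂) p x u = w := by
  obtain ⟨v, rfl⟩ := hp.surjective x w
  obtain ⟨h, k, rfl, hh, hk⟩ := exists_isHorizontal_add (E₂ := E₂) g₁ p x v
  exact ⟨h, hh, by rw [map_add, hk, add_zero]⟩

end RiemannianSubmersion

theorem contMDiff_log_comp {E : Type*} [NormedAddCommGroup E] [NormedSpace ℝ E] {M : Type*}
    [TopologicalSpace M] [ChartedSpace E M]
    {α : M → ℝ} (hα : ContMDiff 𝓘(ℝ, E) 𝓘(ℝ, ℝ) 2 α) (hpos : ∀ y, 0 < α y) :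
    ContMDiff 𝓘(ℝ, E) 𝓘(ℝ, ℝ) 2 (fun y => Real.log (α y)) := fun y =>
  ContMDiffAt.comp y (g := Real.log) (contMDiffAt_iff_contDiffAt.2
    (Real.contDiffAt_log.2 (hpos y).ne')) (hα y)

/-! ### Condition metrics and comparison of 2-jets. -/

section ConditionMetric

set_option maxSynthPendingDepth 3

variable {E₁ : Type*} [NormedAddCommGroup E₁] [NormedSpace ℝ E₁] [FiniteDimensional ℝ E₁]
  {M₁ : Type*} [TopologicalSpace M₁] [ChartedSpace E₁ M₁] [IsManifold 𝓘(ℝ, E₁) ∞ M₁]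
  {E₂ : Type*} [NormedAddCommGroup E₂] [NormedSpace ℝ E₂]
  {M₂ : Type*} [TopologicalSpace M₂] [ChartedSpace E₂ M₂] [IsManifold 𝓘(ℝ, E₂) ∞ M₂]
  {g₁ : MetricOn ∞ E₁ M₁} {g₂ : MetricOn ∞ E₂ M₂} {p : M₁ → M₂}

theorem IsRiemannianSubmersion.conditionMetric_mfderiv_le (hp : IsRiemannianSubmersion g₁ g₂ p)
    {α : M₂ → ℝ} (hα : ContMDiff 𝓘(ℝ, E₂) 𝓘(ℝ, ℝ) 2 α) (hpos : ∀ y, 0 < α y) (x : M₁)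
    (u : TangentSpace 𝓘(ℝ, E₁) x) :
    (conditionMetric g₂ α hα hpos).inner (p x) (mfderiv 𝓘(ℝ, E₁) 𝓘(ℝ, E₂) p x u)
        (mfderiv 𝓘(ℝ, E₁) 𝓘(ℝ, E₂) p x u)
      ≤ (conditionMetric g₁ (α ∘ p) (hp.contMDiff_comp hα) (fun x => hpos (p x))).inner x u u :=
  mul_le_mul_of_nonneg_left (hp.inner_mfderiv_le x u) (hpos (p x)).le

/-- In coordinates, each vector has a lift which is horizontal for the condition metrics. -/
theorem IsRiemannianSubmersion.exists_lift_metricForm (hp : IsRiemannianSubmersion g₁ g₂ p)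
    {α : M₂ → ℝ} (hα : ContMDiff 𝓘(ℝ, E₂) 𝓘(ℝ, ℝ) 2 α) (hpos : ∀ y, 0 < α y)
    {e₁ : OpenPartialHomeomorph M₁ E₁} {e₂ : OpenPartialHomeomorph M₂ E₂} {z : E₁}
    (he₁ : e₁ ∈ atlas E₁ M₁) (he₂ : e₂ ∈ atlas E₂ M₂) (hz : z ∈ e₁.target)
    (hpz : p (e₁.symm z) ∈ e₂.source) (w : E₂) :
    ∃ u : E₁, fderiv ℝ (e₂ ∘ p ∘ e₁.symm) z u = w ∧
      ∀ x, metricForm (conditionMetric g₂ α hα hpos) e₂ ((e₂ ∘ p ∘ e₁.symm) z)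
          (fderiv ℝ (e₂ ∘ p ∘ e₁.symm) z u) (fderiv ℝ (e₂ ∘ p ∘ e₁.symm) z x)
        = metricForm (conditionMetric g₁ (α ∘ p) (hp.contMDiff_comp hα) (fun x => hpos (p x)))
          e₁ z u x := by
  have hp2 : ContMDiff 𝓘(ℝ, E₁) 𝓘(ℝ, E₂) 2 p := hp.contMDiff.of_le (by exact ENat.LEInfty.out)
  have hfz : (e₂ ∘ p ∘ e₁.symm) z ∈ e₂.target := e₂.map_source hpz
  obtain ⟨h, hh, hhw⟩ := hp.exists_isHorizontal_lift (e₁.symm z)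
    (mfderiv 𝓘(ℝ, E₂) 𝓘(ℝ, E₂) e₂.symm ((e₂ ∘ p ∘ e₁.symm) z) w : E₂)
  obtain ⟨u, rfl⟩ : ∃ u : E₁, mfderiv 𝓘(ℝ, E₁) 𝓘(ℝ, E₁) e₁.symm z u = h :=
    (mdifferentiable_of_mem_atlas (I := 𝓘(ℝ, E₁)) he₁).symm.mfderiv_surjective hz h
  refine ⟨u, ?_, fun x => ?_⟩
  · apply (mdifferentiable_of_mem_atlas (I := 𝓘(ℝ, E₂)) he₂).symm.mfderiv_injective hfz
    exact (mfderiv_symm_fderiv_coordinates hp2 he₁ he₂ hz hpz u).trans hhw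
  · rw [metricForm_fderiv_coordinates _ hp2 he₁ he₂ hz hpz]
    exact congrArg (fun r => α (p (e₁.symm z)) * r) (hp.inner_mfderiv_of_isHorizontal hh _)

variable [FiniteDimensional ℝ E₂]

/-- A curve `c` starting horizontally above a geodesic `γ` and satisfying the geodesic equation
projects to a curve having the same second derivative as `γ` at the starting point. -/
theorem IsRiemannianSubmersion.deriv_deriv_eq (hp : IsRiemannianSubmersion g₁ g₂ p)
    {α : M₂ → ℝ} (hα : ContMDiff 𝓘(ℝ, E₂) 𝓘(ℝ, ℝ) 2 α) (hpos : ∀ y, 0 < α y)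
    {e₁ : OpenPartialHomeomorph M₁ E₁} {e₂ : OpenPartialHomeomorph M₂ E₂}
    (he₁ : e₁ ∈ atlas E₁ M₁) (he₂ : e₂ ∈ atlas E₂ M₂) {c : ℝ → E₁} {d : ℝ → E₂} {t : ℝ}
    (hz : c t ∈ e₁.target) (hpz : p (e₁.symm (c t)) ∈ e₂.source) (hc : ContDiffAt ℝ 2 c t)
    (hc0 : ∀ w, geodesicDefect (metricForm (conditionMetric g₁ (α ∘ p) (hp.contMDiff_comp hα)
      (fun x => hpos (p x))) e₁) c t w = 0)
    (hd0 : ∀ w, geodesicDefect (metricForm (conditionMetric g₂ α hα hpos) e₂) d t w = 0)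
    (hcd : ((e₂ ∘ p ∘ e₁.symm) ∘ c) t = d t)
    (hcd' : deriv ((e₂ ∘ p ∘ e₁.symm) ∘ c) t = deriv d t)
    (hv : ∀ x, metricForm (conditionMetric g₂ α hα hpos) e₂ ((e₂ ∘ p ∘ e₁.symm) (c t))
          (fderiv ℝ (e₂ ∘ p ∘ e₁.symm) (c t) (deriv c t)) (fderiv ℝ (e₂ ∘ p ∘ e₁.symm) (c t) x)
        = metricForm (conditionMetric g₁ (α ∘ p) (hp.contMDiff_comp hα) (fun x => hpos (p x)))
          e₁ (c t) (deriv c t) x) :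
    deriv (deriv ((e₂ ∘ p ∘ e₁.symm) ∘ c)) t = deriv (deriv d) t := by
  have hp2 : ContMDiff 𝓘(ℝ, E₁) 𝓘(ℝ, E₂) 2 p := hp.contMDiff.of_le (by exact ENat.LEInfty.out)
  have hdt : d t ∈ e₂.target := hcd ▸ e₂.map_source hpz
  have key : ∀ w, metricForm (conditionMetric g₂ α hα hpos) e₂ (d t)
      (deriv (deriv ((e₂ ∘ p ∘ e₁.symm) ∘ c)) t - deriv (deriv d) t) w = 0 := by
    intro w
    obtain ⟨u, rfl, hu⟩ := hp.exists_lift_metricForm hα hpos he₁ he₂ hz hpz w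
    have h1 := geodesicDefect_map hp2 (hp.conditionMetric_mfderiv_le hα hpos) he₁ he₂ hc hz hpz
      hv hu
    have h2 := hd0 (fderiv ℝ (e₂ ∘ p ∘ e₁.symm) (c t) u)
    rw [hc0] at h1
    unfold geodesicDefect at h1 h2
    rw [hcd, hcd'] at h1
    rw [map_sub, sub_apply]
    linarith
  -- The Christoffel terms have cancelled; testing with the difference of accelerations itself
  -- contradicts positivity.
  by_contra hne
  exact (metricForm_pos (conditionMetric g₂ α hα hpos) he₂ hdt (sub_ne_zero.2 hne)).ne' (key _)

theorem IsRiemannianSubmersion.deriv_deriv_log_nonneg (hp : IsRiemannianSubmersion g₁ g₂ p)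
    {α : M₂ → ℝ} (hα : ContMDiff 𝓘(ℝ, E₂) 𝓘(ℝ, ℝ) 2 α) (hpos : ∀ y, 0 < α y)
    {U : Set M₂} (hU : IsOpen U)
    (hconv : SelfConvexOn g₁ (α ∘ p) (hp.contMDiff_comp hα) (fun x => hpos (p x)) (p ⁻¹' U))
    {γ : ℝ → M₂} {J : Set ℝ} (hγ : IsGeodesicOn (conditionMetric g₂ α hα hpos) γ J) {t : ℝ}
    (ht : t ∈ interior J) (htU : γ t ∈ U) {x : M₁} (hx : p x = γ t) :
    0 ≤ deriv (deriv fun s => Real.log (α (γ s))) t := by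
  have hp2 : ContMDiff 𝓘(ℝ, E₁) 𝓘(ℝ, E₂) 2 p := hp.contMDiff.of_le (by exact ENat.LEInfty.out)
  have hlog := contMDiff_log_comp hα hpos
  set e₁ := chartAt E₁ x
  set e₂ := chartAt E₂ (γ t)
  have he₁ : e₁ ∈ atlas E₁ M₁ := chart_mem_atlas E₁ x
  have he₂ : e₂ ∈ atlas E₂ M₂ := chart_mem_atlas E₂ (γ t)
  have hte : γ t ∈ e₂.source := mem_chart_source E₂ (γ t)
  have hxe : x ∈ e₁.source := mem_chart_source E₁ x
  set f := e₂ ∘ p ∘ e₁.symm with hf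
  have hz : e₁ x ∈ e₁.target := e₁.map_source hxe
  have hpx : p (e₁.symm (e₁ x)) = γ t := by rw [e₁.left_inv hxe, hx]
  have hpz : p (e₁.symm (e₁ x)) ∈ e₂.source := hpx ▸ hte
  obtain ⟨u, hu, hhor⟩ := hp.exists_lift_metricForm hα hpos he₁ he₂ hz hpz (deriv (e₂ ∘ γ) t)
  set G₁ := conditionMetric g₁ (α ∘ p) (hp.contMDiff_comp hα) (fun x => hpos (p x))
  -- On this open set the lifted geodesic projects into `U`, as self-convexity demands, and into the
  -- chart `e₂`.
  have hV : IsOpen (e₁.target ∩ e₁.symm ⁻¹' (p ⁻¹' (U ∩ e₂.source))) :=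
    e₁.isOpen_inter_preimage_symm ((hU.inter e₂.open_source).preimage hp2.continuous)
  obtain ⟨c, ε, hε, hct, hc't, hc⟩ := exists_geodesic_of_contDiffOn hV
    ((contDiffOn_metricForm G₁ he₁).mono inter_subset_left)
    (fun y hy v hv => metricForm_pos G₁ he₁ hy.1 hv)
    (show e₁ x ∈ _ from ⟨hz, by rw [mem_preimage, mem_preimage, hpx]; exact ⟨htU, hte⟩⟩) u t
  set I := Ioo (t - ε) (t + ε)
  have htI : t ∈ I := ⟨by linarith, by linarith⟩
  have hgeod : IsGeodesicOn G₁ (e₁.symm ∘ c) I :=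
    isGeodesicOn_symm_comp he₁ ordConnected_Ioo (fun s hs => (hc s hs).1.1)
      (fun s hs => (hc s hs).2.1) (fun s hs => (hc s hs).2.2)
  have hψ := hconv _ I hgeod fun s hs => (hc s hs).1.2.1
  have hψd : ∀ s ∈ I, DifferentiableAt ℝ (fun s => Real.log ((α ∘ p) ((e₁.symm ∘ c) s))) s := by
    intro s hs
    have h1 := hgeod.contMDiffOn.contMDiffAt (isOpen_Ioo.mem_nhds hs)
    exact (contMDiffAt_iff_contDiffAt.1
      ((hlog.comp hp2).contMDiffAt.comp s h1)).differentiableAt two_ne_zero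
  have hnonneg := hψ.deriv_deriv_nonneg isOpen_Ioo hψd htI
  have hc2 := (hc t htI).2.1
  set l : E₂ → ℝ := fun y => Real.log (α (e₂.symm y)) with hl
  have hγc : ContinuousAt γ t :=
    (hγ.contMDiffOn.contMDiffAt (mem_interior_iff_mem_nhds.1 ht)).continuousAt
  have e2 : (fun s => Real.log (α (γ s))) =ᶠ[𝓝 t] l ∘ (e₂ ∘ γ) := by
    filter_upwards [hγc.preimage_mem_nhds (e₂.open_source.mem_nhds hte)] with s hs
    simp only [hl, Function.comp_apply]
    rw [e₂.left_inv hs]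
  have e1 : (fun s => Real.log ((α ∘ p) ((e₁.symm ∘ c) s))) =ᶠ[𝓝 t] l ∘ (f ∘ c) := by
    filter_upwards [isOpen_Ioo.mem_nhds htI] with s hs
    simp only [hl, hf, Function.comp_apply]
    rw [e₂.left_inv (hc s hs).1.2.2]
  have hfct : f (c t) = (e₂ ∘ γ) t := by
    simp only [hf, Function.comp_apply]
    rw [hct, hpx]
  rw [← hct] at hz hpz hhor hu
  have hf2 : ContDiffAt ℝ 2 f (c t) := contDiffAt_coordinates hp2 he₁ he₂ hz hpz
  have hfc' : deriv (f ∘ c) t = deriv (e₂ ∘ γ) t := by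
    rw [deriv_comp_of_contDiffAt_two hf2 hc2, hc't, hu]
  have hγ2 := hγ.contDiffAt_chart he₂ ht hte
  have hfc'' : deriv (deriv (f ∘ c)) t = deriv (deriv (e₂ ∘ γ)) t :=
    hp.deriv_deriv_eq hα hpos he₁ he₂ hz hpz hc2 (hc t htI).2.2
      (hγ.geodesicDefect_eq_zero he₂ ht hte) hfct hfc' (by rw [hc't]; exact hhor)
  have hl2 : ContDiffAt ℝ 2 l ((e₂ ∘ γ) t) := by
    have h1 : ContMDiffAt 𝓘(ℝ, E₂) 𝓘(ℝ, E₂) ∞ e₂.symm ((e₂ ∘ γ) t) :=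
      contMDiffAt_symm_of_mem_maximalAtlas (IsManifold.subset_maximalAtlas he₂)
        (e₂.map_source hte)
    exact contMDiffAt_iff_contDiffAt.1
      (hlog.contMDiffAt.comp _ (h1.of_le (by exact ENat.LEInfty.out)))
  have hl2' : ContDiffAt ℝ 2 l ((f ∘ c) t) := by rwa [Function.comp_apply, hfct]
  -- Both second derivatives are now the same expression in the common 2-jet of `f ∘ c` and `e₂ ∘
  -- γ`.
  rw [e1.deriv.deriv_eq, deriv_deriv_comp_of_contDiffAt_two hl2' (hf2.comp t hc2), hfc', hfc'',
    Function.comp_apply, hfct] at hnonneg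
  rwa [e2.deriv.deriv_eq, deriv_deriv_comp_of_contDiffAt_two hl2 hγ2]

end ConditionMetric

/-! ### The proposition. -/

theorem mainTheorem11
    {E₁ : Type*} [NormedAddCommGroup E₁] [NormedSpace ℝ E₁] [FiniteDimensional ℝ E₁]
    {M₁ : Type*} [TopologicalSpace M₁] [ChartedSpace E₁ M₁] [IsManifold 𝓘(ℝ, E₁) ∞ M₁]
    {E₂ : Type*} [NormedAddCommGroup E₂] [NormedSpace ℝ E₂] [FiniteDimensional ℝ E₂]
    {M₂ : Type*} [TopologicalSpace M₂] [ChartedSpace E₂ M₂] [IsManifold 𝓘(ℝ, E₂) ∞ M₂]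
    (g₁ : MetricOn ∞ E₁ M₁) (g₂ : MetricOn ∞ E₂ M₂)
    (p : M₁ → M₂) (hp : IsRiemannianSubmersion g₁ g₂ p)
    (α₂ : M₂ → ℝ) (hα₂ : ContMDiff 𝓘(ℝ, E₂) 𝓘(ℝ, ℝ) 2 α₂) (hpos : ∀ y, 0 < α₂ y)
    (U₂ : Set M₂) (hU₂ : IsOpen U₂) (hrange : U₂ ⊆ Set.range p)
    (hconv : SelfConvexOn g₁ (α₂ ∘ p) (hp.contMDiff_comp hα₂) (fun x => hpos (p x)) (p ⁻¹' U₂)) :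
    SelfConvexOn g₂ α₂ hα₂ hpos U₂ := by

  intro γ J hγ hmaps
  have hφ : ContDiffOn ℝ 2 (fun t => Real.log (α₂ (γ t))) J :=
    contMDiffOn_iff_contDiffOn.1
      ((contMDiff_log_comp hα₂ hpos).comp_contMDiffOn hγ.contMDiffOn)
  have hφ2 : ∀ t ∈ interior J, ContDiffAt ℝ 2 (fun t => Real.log (α₂ (γ t))) t := fun t ht =>
    hφ.contDiffAt (mem_interior_iff_mem_nhds.1 ht)
  -- Only interior times need the sign; continuity on `J` covers the end points.
  refine convexOn_of_deriv2_nonneg hγ.ordConnected.convex hφ.continuousOn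
    (fun t ht => ((hφ2 t ht).differentiableAt two_ne_zero).differentiableWithinAt)
    (fun t ht => (hφ2 t ht).differentiableAt_deriv_of_two.differentiableWithinAt) fun t ht => ?_
  have htU := hmaps (interior_subset ht)
  obtain ⟨x, hx⟩ := hrange htU
  exact hp.deriv_deriv_log_nonneg hα₂ hpos hU₂ hconv hγ ht htU hx
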